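/- Let $m,n\ge 0$. Let $G_{m,n}$ be the graph with vertices $v_{i,j}$, $0\le i\le m+1$, $0\le j\le n+1$ (the four corners $v_{0,0},v_{0,n+1},v_{m+1,0},v_{m+1,n+1}$ removed; $i$ is the row, counted from the top, and $j$ the column, counted from the left), and edges $v_{i,j}v_{i+1,j}$ for $0\le i\le m$, $1\le j\le n$ and $v_{i,j}v_{i,j+1}$ for $1\le i\le m$, $0\le j\le n$. The vertices $v_{i,j}$ with $1\le i\le m$, $1\le j\le n$ are called interior. An $(m,n)$-partial fully-packed loop configuration is a spanning subgraph $F$ of $G_{m,n}$ in which each interior vertex has exactly two incident edges and such that, for $1\le j\le n$, the edge $v_{0,j}v_{1,j}$ is in $F$ if and only if $j$ is odd and, for $1\le i\le m$, the edge $v_{i,0}v_{i,1}$ is in $F$ if and only if $i$ is even. For $0\le i\le m$, $0\le j\le n$, the square with upper-left corner at position $(i,j)$ has the positions $(i,j)$, $(i,j+1)$, $(i+1,j)$, $(i+1,j+1)$ as corners; it is even or odd according to the parity of $i+j$. The local action does nothing on squares with $i=0$ or $j=0$. On any other square, if the edges of $F$ on the square are exactly the horizontal edges of $G_{m,n}$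 on it (top and bottom; only top when $i=m$), they are replaced by the vertical edges of $G_{m,n}$ on it (left and right; only left when $j=n$), and vice versa; in all other cases nothing changes. Gyration performs the local action on all even squares, and then on all odd squares. The partial link pattern of $F$ is defined as follows. Label the left boundary vertices $v_{i,0}$ with $i$ even, $1\le i\le m$, from bottom to top, and then the top boundary vertices $v_{0,j}$ with $j$ odd, $1\le j\le n$, from left to right, by $1,2,\dots,\lfloor m/2\rfloor+\lceil n/2\rceil$. Two distinct labels are connected in the partial link pattern if their vertices are joined by a path in $F$. A number outside $\{1,\dots,\lfloor m/2\rfloor+\lceil n/2\rceil\}$ (in particular $0$) is not a label and is connected to nothing. Corollary. Let $F$ be an $(m,n)$-partial fully-packed loop configuration and let $F'$ be the result of applying gyration to $F$. Then $F'$ is again an $(m,n)$-partial fully-packed loop configuration, and gyration acts as a partial rotation on partial link patterns: whenever $i$ and $j$ are connected in the partial link pattern of $F$, then in the partial link pattern of $F'$ either $i-1$ and $j-1$ are connected to each other, or neither $i-1$ nor $j-1$ is connected to any label. (In particular, if $i=1$, then $j-1$ is not connected to any label.) -/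

import Mathlib

/-- The graph `G_{m,n}`. The vertex `v_{i,j}` is the pair `(i, j)`, with `0 ≤ i ≤ m + 1` and
`0 ≤ j ≤ n + 1`, the four corners excluded; all other pairs of natural numbers are isolated.
The edges are `v_{i,j} v_{i+1,j}` for `0 ≤ i ≤ m`, `1 ≤ j ≤ n` and `v_{i,j} v_{i,j+1}` for
`1 ≤ i ≤ m`, `0 ≤ j ≤ n`. The interior vertices are those with `1 ≤ i ≤ m`, `1 ≤ j ≤ n`. -/
def gridGraph (m n : ℕ) : SimpleGraph (ℕ × ℕ) :=
  SimpleGraph.fromEdgeSet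
    ({e | ∃ i j : ℕ, i ≤ m ∧ 1 ≤ j ∧ j ≤ n ∧ e = s((i, j), (i + 1, j))} ∪
      {e | ∃ i j : ℕ, 1 ≤ i ∧ i ≤ m ∧ j ≤ n ∧ e = s((i, j), (i, j + 1))})

/-- `F` is an `(m,n)`-partial fully-packed loop configuration: a (spanning) subgraph of `G_{m,n}`
whose edges at the top boundary are exactly the `v_{0,j} v_{1,j}` with `j` odd, whose edges at the
left boundary are exactly the `v_{i,0} v_{i,1}` with `i` even, and in which every interior vertex
has exactly two incident edges. -/
structure IsPartialFPL (m n : ℕ) (F : SimpleGraph (ℕ × ℕ)) : Prop where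
  le_grid : F ≤ gridGraph m n
  top_boundary : ∀ j : ℕ, 1 ≤ j → j ≤ n → (F.Adj (0, j) (1, j) ↔ Odd j)
  left_boundary : ∀ i : ℕ, 1 ≤ i → i ≤ m → (F.Adj (i, 0) (i, 1) ↔ Even i)
  degree_two : ∀ i j : ℕ, 1 ≤ i → i ≤ m → 1 ≤ j → j ≤ n → (F.neighborSet (i, j)).ncard = 2

/-- The horizontal edges of `G_{m,n}` (top and bottom, as far as they belong to `G_{m,n}`) of the
square whose upper-left corner is `v_{i,j}`. -/
def squareHoriz (m n i j : ℕ) : Set (Sym2 (ℕ × ℕ)) :=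
  {s((i, j), (i, j + 1)), s((i + 1, j), (i + 1, j + 1))} ∩ (gridGraph m n).edgeSet

/-- The vertical edges of `G_{m,n}` (left and right, as far as they belong to `G_{m,n}`) of the
square whose upper-left corner is `v_{i,j}`. -/
def squareVert (m n i j : ℕ) : Set (Sym2 (ℕ × ℕ)) :=
  {s((i, j), (i + 1, j)), s((i, j + 1), (i + 1, j + 1))} ∩ (gridGraph m n).edgeSet

open Classical in
/-- The local action on the square with upper-left corner `v_{i,j}` (`0 ≤ i ≤ m`, `0 ≤ j ≤ n`).
If the square is in the first row or column (`i = 0` or `j = 0`), nothing happens. Otherwise, if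
the edges of `F` on the square are exactly its horizontal edges, they are replaced by its vertical
edges, and vice versa; in all other cases nothing happens. Explicitly:
* interior square (`i < m`, `j < n`): top and bottom are swapped with left and right;
* far right, not a corner (`i < m`, `j = n`; no right edge): top and bottom are swapped with left;
* bottom, not a corner (`i = m`, `j < n`; no bottom edge): top is swapped with left and right;
* bottom-right corner (`i = m`, `j = n`): top is swapped with left. -/
noncomputable def localAction (m n i j : ℕ) (F : SimpleGraph (ℕ × ℕ)) : SimpleGraph (ℕ × ℕ) :=
  if i = 0 ∨ j = 0 then F
  else if F.edgeSet ∩ (squareHoriz m n i j ∪ squareVert m n i j) = squareHoriz m n i j then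
    SimpleGraph.fromEdgeSet ((F.edgeSet \ squareHoriz m n i j) ∪ squareVert m n i j)
  else if F.edgeSet ∩ (squareHoriz m n i j ∪ squareVert m n i j) = squareVert m n i j then
    SimpleGraph.fromEdgeSet ((F.edgeSet \ squareVert m n i j) ∪ squareHoriz m n i j)
  else F

/-- Perform the local action on all squares whose upper-left corner `v_{i,j}` has `i + j` in the
class `P` (`P` is `Even` or `Odd`). Each edge of `G_{m,n}` lies in exactly one even and exactly one
odd square, so the local actions on the squares of one parity do not interfere: on each such
square, the new configuration is the result of the local action on that square. -/
noncomputable def actOnSquares (m n : ℕ) (P : ℕ → Prop) (F : SimpleGraph (ℕ × ℕ)) :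
    SimpleGraph (ℕ × ℕ) :=
  SimpleGraph.fromEdgeSet
    {e | ∃ i j : ℕ, i ≤ m ∧ j ≤ n ∧ P (i + j) ∧
      e ∈ squareHoriz m n i j ∪ squareVert m n i j ∧ e ∈ (localAction m n i j F).edgeSet}

/-- Gyration: the local action on all even squares, then on all odd squares. -/
noncomputable def gyration (m n : ℕ) (F : SimpleGraph (ℕ × ℕ)) : SimpleGraph (ℕ × ℕ) :=
  actOnSquares m n Odd (actOnSquares m n Even F)

/-- The number of fixed boundary edges on the left and top, `⌊m/2⌋ + ⌈n/2⌉`. -/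
def numLabels (m n : ℕ) : ℕ := m / 2 + (n + 1) / 2

/-- The boundary vertex carrying the label `l`, for `1 ≤ l ≤ numLabels m n`. The labels start with
`1` at the lowest `v_{i,0}` with `i` even, `1 ≤ i ≤ m`, go up the left side (labels
`1, …, ⌊m/2⌋`), and continue along the top from left to right through the `v_{0,j}`,
`j = 1, 3, 5, …`. -/
def labelVertex (m l : ℕ) : ℕ × ℕ :=
  if l ≤ m / 2 then (2 * (m / 2 + 1 - l), 0) else (0, 2 * (l - m / 2) - 1)

/-- `a` and `b` are two distinct labels connected by an arc in the partial link pattern of `F`,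
that is, connected by a path in `F`. -/
def LinkConnected (m n : ℕ) (F : SimpleGraph (ℕ × ℕ)) (a b : ℕ) : Prop :=
  a ∈ Finset.Icc 1 (numLabels m n) ∧ b ∈ Finset.Icc 1 (numLabels m n) ∧ a ≠ b ∧
    F.Reachable (labelVertex m a) (labelVertex m b)

/-!
Gyration is written as a product of two half-steps. A half-step on the squares of one parity
is the local action on these squares followed by taking the complement in the grid. Since the
local action commutes with taking complements, the complements cancel, and gyration is the
half-step on the even squares followed by the half-step on the odd squares (`IsHalfStep`,
`isHalfStep_sdiff_actOnSquares`, `isHalfStep_actOnSquares_sdiff`).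

In a half-step on the squares of parity `P`, every edge lies in exactly one `P`-square and every
inner vertex in exactly two. On a square with exactly the horizontal or exactly the vertical edges
nothing changes; on every other square the configuration is replaced by its complement. Hence
inner vertices keep degree two (`IsHalfStep.twoEdgesAt`), and the alternating boundary condition on
the left and top is complemented, so that two half-steps restore it.

A crossing is an inner vertex with one edge in each of its two `P`-squares. Within a square, the
corners with exactly one edge are joined in the complement in the same way as before
(`exists_value_of_compl`). So paths between crossings survive, while in a `P`-square on the left or
top boundary, where exactly one of the two boundary edges is present, the end of the path moves to
the other boundary vertex (`boundaryMove`, `IsHalfStep.reachable`). The bookkeeping avoids paths: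
a predicate which is constant on the components of the new configuration is transported to one
which is constant along the edges of the old one (`SimpleGraph.Reachable.transfer_of_pieces`).

Numbering the left and top boundary vertices consecutively (`boundaryVertex`), the labels occupy
every second position, and each of the two half-steps moves a label by one position, so gyration
moves it to the previous label. The lowest label is moved to the lower boundary instead. If label
`i` is connected to label `1`, then after gyration `i - 1` lies on a path that ends on the lower
boundary; a path has only two ends (`SimpleGraph.eq_or_eq_of_reachable_of_degree_le_one`), so
`i - 1` is not connected to any label. When `m` is even, the lower boundary is reached after the
first half-step already, and the argument takes place between the two half-steps, using that a
half-step is an involution (`IsHalfStep.symm`).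
-/

/-! ### Three ends of one path -/

/-- In a graph of maximum degree two, a connected component is a path or a cycle, so it contains
at most two vertices of degree at most one. -/
theorem SimpleGraph.eq_or_eq_of_reachable_of_degree_le_one {V : Type*} {G : SimpleGraph V}
    (hdeg : ∀ u a b c, G.Adj u a → G.Adj u b → G.Adj u c → a = b ∨ a = c ∨ b = c)
    {x y z : V} (hx : ∀ a b, G.Adj x a → G.Adj x b → a = b)
    (hy : ∀ a b, G.Adj y a → G.Adj y b → a = b)
    (hz : ∀ a b, G.Adj z a → G.Adj z b → a = b) (hxy : G.Reachable x y) (hne : x ≠ y)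
    (hxz : G.Reachable x z) : z = x ∨ z = y := by
  obtain ⟨w, hw⟩ := hxy.exists_isPath
  have hlen : 0 < w.length := by
    rcases Nat.eq_zero_or_pos w.length with h | h
    · exact absurd (SimpleGraph.Walk.eq_of_length_eq_zero h) hne
    · exact h
  -- Two neighbours on the path of an inner vertex of the path are distinct.
  have hdist : ∀ i, i + 2 ≤ w.length → w.getVert i ≠ w.getVert (i + 2) := by
    intro i hi h
    have := hw.getVert_injOn (by simp; omega) (by simp; omega) h
    omega
  have hadj : ∀ i, i < w.length → G.Adj (w.getVert i) (w.getVert (i + 1)) :=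
    fun i hi => w.adj_getVert_succ hi
  have hclosed : ∀ a b, G.Adj a b → a ∈ w.support → b ∈ w.support := by
    intro a b hab ha
    rw [SimpleGraph.Walk.mem_support_iff_exists_getVert] at ha ⊢
    obtain ⟨i, rfl, hi⟩ := ha
    rcases Nat.eq_zero_or_pos i with rfl | hpos
    · refine ⟨1, ?_, hlen⟩
      have h1 := hadj 0 hlen
      rw [SimpleGraph.Walk.getVert_zero] at h1 hab
      exact hx _ _ h1 hab
    obtain ⟨k, rfl⟩ := Nat.exists_eq_add_of_le' hpos
    rcases Nat.lt_or_ge (k + 1) w.length with hlt | hge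
    · rcases hdeg _ _ _ _ (hadj k (by omega)).symm (hadj (k + 1) hlt) hab with h | h | h
      · exact absurd h (hdist k (by omega))
      · exact ⟨k, h, by omega⟩
      · exact ⟨k + 2, h, by omega⟩
    · have hk : k + 1 = w.length := by omega
      refine ⟨k, ?_, by omega⟩
      have h1 := (hadj k (by omega)).symm
      rw [hk, SimpleGraph.Walk.getVert_length] at h1 hab
      exact hy _ _ h1 hab
  have hzs : z ∈ w.support := by
    obtain ⟨q⟩ := hxz
    have : ∀ {a b : V}, G.Walk a b → a ∈ w.support → b ∈ w.support := by
      intro a b q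
      induction q with
      | nil => exact id
      | cons h _ ih => exact fun ha => ih (hclosed _ _ h ha)
    exact this q w.start_mem_support
  rw [SimpleGraph.Walk.mem_support_iff_exists_getVert] at hzs
  obtain ⟨i, rfl, hi⟩ := hzs
  rcases Nat.eq_zero_or_pos i with rfl | hpos
  · exact Or.inl w.getVert_zero
  obtain ⟨k, rfl⟩ := Nat.exists_eq_add_of_le' hpos
  rcases Nat.lt_or_ge (k + 1) w.length with hlt | hge
  · exact absurd (hz _ _ (hadj k (by omega)).symm (hadj (k + 1) hlt)) (hdist k (by omega))
  · right
    rw [show k + 1 = w.length by omega, SimpleGraph.Walk.getVert_length]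

/-! ### Transfer of connectivity between two graphs cut into pieces -/

/-- Let the edges of `F` be covered by pieces `A q` such that every vertex outside `L` meets at
most one piece. Suppose that, for every predicate `p` which is constant on the components of `D`,
each piece `A q` carries a predicate, constant along the edges of the piece, which agrees with
`p ∘ φ` at the vertices of the piece in `L`. Then `φ` maps vertices of `L` in one component of `F`
to vertices in one component of `D`. -/
theorem SimpleGraph.Reachable.transfer_of_pieces {V ι : Type*} {F D : SimpleGraph V}
    (A : ι → V → V → Prop) (hsymm : ∀ q u v, A q u v → A q v u)
    (hF : ∀ u v, F.Adj u v → ∃ q, A q u v) (L : V → Prop) (φ : V → V)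
    (huniq : ∀ u, ¬ L u → ∀ q q' v v', A q u v → A q' u v' → q = q')
    (hpiece : ∀ p : V → Prop, (∀ u v, D.Adj u v → (p u ↔ p v)) → ∀ q, ∃ r : V → Prop,
      (∀ u v, A q u v → (r u ↔ r v)) ∧ ∀ u v, L u → A q u v → (r u ↔ p (φ u)))
    {u v : V} (hu : L u) (hv : L v) (huv : F.Reachable u v) : D.Reachable (φ u) (φ v) := by
  classical
  choose r hr hrL using hpiece (fun w => D.Reachable (φ u) w)
    (fun a b hab => ⟨fun h => h.trans hab.reachable, fun h => h.trans hab.symm.reachable⟩)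
  let p' : V → Prop := fun w =>
    if L w then D.Reachable (φ u) (φ w) else ∃ q v, A q w v ∧ r q w
  have key : ∀ q a b, A q a b → (p' a ↔ r q a) := by
    intro q a b hab
    by_cases ha : L a
    · simp only [p', if_pos ha]
      exact (hrL q a b ha hab).symm
    · simp only [p', if_neg ha]
      constructor
      · rintro ⟨q', b', hab', h⟩
        rwa [huniq a ha q q' b b' hab hab']
      · exact fun h => ⟨q, b, hab, h⟩
  have hstep : ∀ a b, F.Adj a b → p' a → p' b := by
    intro a b hab h
    obtain ⟨q, hq⟩ := hF a b hab
    exact (key q b a (hsymm _ _ _ hq)).2 ((hr q a b hq).1 ((key q a b hq).1 h))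
  have hwalk : ∀ {a b : V}, F.Walk a b → p' a → p' b := by
    intro a b q
    induction q with
    | nil => exact id
    | cons h _ ih => exact fun ha => ih (hstep _ _ h ha)
  obtain ⟨w⟩ := huv
  have := hwalk w (by simp only [p', if_pos hu]; exact SimpleGraph.Reachable.refl _)
  simpa only [p', if_pos hv] using this

/-! ### Edges of the grid -/

theorem gridGraph_adj_horiz {m n i j : ℕ} :
    (gridGraph m n).Adj (i, j) (i, j + 1) ↔ 1 ≤ i ∧ i ≤ m ∧ j ≤ n := by
  simp only [gridGraph, SimpleGraph.fromEdgeSet_adj, Set.mem_union, Set.mem_ofPred_eq,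
    Sym2.eq_iff, Prod.mk.injEq, ne_eq]
  constructor
  · rintro ⟨⟨a, b, h⟩ | ⟨a, b, h⟩, -⟩ <;> omega
  · rintro h
    exact ⟨Or.inr ⟨i, j, by omega⟩, by omega⟩

theorem gridGraph_adj_vert {m n i j : ℕ} :
    (gridGraph m n).Adj (i, j) (i + 1, j) ↔ i ≤ m ∧ 1 ≤ j ∧ j ≤ n := by
  simp only [gridGraph, SimpleGraph.fromEdgeSet_adj, Set.mem_union, Set.mem_ofPred_eq,
    Sym2.eq_iff, Prod.mk.injEq, ne_eq]
  constructor
  · rintro ⟨⟨a, b, h⟩ | ⟨a, b, h⟩, -⟩ <;> omega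
  · rintro h
    exact ⟨Or.inl ⟨i, j, by omega⟩, by omega⟩

theorem gridGraph_adj_cases {m n : ℕ} {u v : ℕ × ℕ} (h : (gridGraph m n).Adj u v) :
    ∃ i j, (1 ≤ i ∧ i ≤ m ∧ j ≤ n ∧
        (u = (i, j) ∧ v = (i, j + 1) ∨ u = (i, j + 1) ∧ v = (i, j))) ∨
      (i ≤ m ∧ 1 ≤ j ∧ j ≤ n ∧
        (u = (i, j) ∧ v = (i + 1, j) ∨ u = (i + 1, j) ∧ v = (i, j))) := by
  simp only [gridGraph, SimpleGraph.fromEdgeSet_adj, Set.mem_union, Set.mem_ofPred_eq,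
    Sym2.eq_iff] at h
  obtain ⟨⟨i, j, h1, h2, h3, h⟩ | ⟨i, j, h1, h2, h3, h⟩, -⟩ := h
  · exact ⟨i, j, Or.inr ⟨h1, h2, h3, h⟩⟩
  · exact ⟨i, j, Or.inl ⟨h1, h2, h3, h⟩⟩

theorem mem_squareHoriz {m n i j : ℕ} {e : Sym2 (ℕ × ℕ)} : e ∈ squareHoriz m n i j ↔
    (e = s((i, j), (i, j + 1)) ∧ 1 ≤ i ∧ i ≤ m ∧ j ≤ n) ∨
      (e = s((i + 1, j), (i + 1, j + 1)) ∧ i < m ∧ j ≤ n) := by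
  simp only [squareHoriz, Set.mem_inter_iff, Set.mem_insert_iff, Set.mem_singleton_iff]
  constructor
  · rintro ⟨rfl | rfl, h⟩ <;> rw [SimpleGraph.mem_edgeSet, gridGraph_adj_horiz] at h
    · exact Or.inl ⟨rfl, h⟩
    · exact Or.inr ⟨rfl, by omega⟩
  · rintro (⟨rfl, h⟩ | ⟨rfl, h⟩) <;> rw [SimpleGraph.mem_edgeSet, gridGraph_adj_horiz]
    · exact ⟨Or.inl rfl, h⟩
    · exact ⟨Or.inr rfl, by omega⟩

theorem mem_squareVert {m n i j : ℕ} {e : Sym2 (ℕ × ℕ)} : e ∈ squareVert m n i j ↔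
    (e = s((i, j), (i + 1, j)) ∧ i ≤ m ∧ 1 ≤ j ∧ j ≤ n) ∨
      (e = s((i, j + 1), (i + 1, j + 1)) ∧ i ≤ m ∧ j < n) := by
  simp only [squareVert, Set.mem_inter_iff, Set.mem_insert_iff, Set.mem_singleton_iff]
  constructor
  · rintro ⟨rfl | rfl, h⟩ <;> rw [SimpleGraph.mem_edgeSet, gridGraph_adj_vert] at h
    · exact Or.inl ⟨rfl, h⟩
    · exact Or.inr ⟨rfl, by omega⟩
  · rintro (⟨rfl, h⟩ | ⟨rfl, h⟩) <;> rw [SimpleGraph.mem_edgeSet, gridGraph_adj_vert]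
    · exact ⟨Or.inl rfl, h⟩
    · exact ⟨Or.inr rfl, by omega⟩

/-! ### The local action in terms of the four sides of a square -/

/-- The edges of `F` on the square at `(i, j)` are exactly the horizontal edges of the square. -/
def OnlyHoriz (m : ℕ) (F : SimpleGraph (ℕ × ℕ)) (i j : ℕ) : Prop :=
  F.Adj (i, j) (i, j + 1) ∧ (F.Adj (i + 1, j) (i + 1, j + 1) ↔ i < m) ∧
    ¬ F.Adj (i, j) (i + 1, j) ∧ ¬ F.Adj (i, j + 1) (i + 1, j + 1)

/-- The edges of `F` on the square at `(i, j)` are exactly the vertical edges of the square. -/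
def OnlyVert (n : ℕ) (F : SimpleGraph (ℕ × ℕ)) (i j : ℕ) : Prop :=
  F.Adj (i, j) (i + 1, j) ∧ (F.Adj (i, j + 1) (i + 1, j + 1) ↔ j < n) ∧
    ¬ F.Adj (i, j) (i, j + 1) ∧ ¬ F.Adj (i + 1, j) (i + 1, j + 1)

/-- `F` and `E` have the same edges on the square at `(i, j)`. -/
def SameOnSquare (F E : SimpleGraph (ℕ × ℕ)) (i j : ℕ) : Prop :=
  (E.Adj (i, j) (i, j + 1) ↔ F.Adj (i, j) (i, j + 1)) ∧
  (E.Adj (i + 1, j) (i + 1, j + 1) ↔ F.Adj (i + 1, j) (i + 1, j + 1)) ∧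
  (E.Adj (i, j) (i + 1, j) ↔ F.Adj (i, j) (i + 1, j)) ∧
  (E.Adj (i, j + 1) (i + 1, j + 1) ↔ F.Adj (i, j + 1) (i + 1, j + 1))

/-- The edges of `F` and of `E` on the square at `(i, j)` are complementary among the edges of
the grid on this square. -/
def ComplOnSquare (m n : ℕ) (F E : SimpleGraph (ℕ × ℕ)) (i j : ℕ) : Prop :=
  (E.Adj (i, j) (i, j + 1) ↔ 1 ≤ i ∧ ¬ F.Adj (i, j) (i, j + 1)) ∧
  (E.Adj (i + 1, j) (i + 1, j + 1) ↔ i < m ∧ ¬ F.Adj (i + 1, j) (i + 1, j + 1)) ∧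
  (E.Adj (i, j) (i + 1, j) ↔ 1 ≤ j ∧ ¬ F.Adj (i, j) (i + 1, j)) ∧
  (E.Adj (i, j + 1) (i + 1, j + 1) ↔ j < n ∧ ¬ F.Adj (i, j + 1) (i + 1, j + 1))

theorem onlyHoriz_iff {m n i j : ℕ} {F : SimpleGraph (ℕ × ℕ)} (hF : F ≤ gridGraph m n)
    (hi : 1 ≤ i) (him : i ≤ m) (hj : 1 ≤ j) (hjn : j ≤ n) :
    F.edgeSet ∩ (squareHoriz m n i j ∪ squareVert m n i j) = squareHoriz m n i j ↔
      OnlyHoriz m F i j := by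
  have hR : F.Adj (i, j + 1) (i + 1, j + 1) → j < n := fun h =>
    (gridGraph_adj_vert.1 (hF h)).2.2
  have hB : F.Adj (i + 1, j) (i + 1, j + 1) → i < m := fun h =>
    (gridGraph_adj_horiz.1 (hF h)).2.1
  constructor
  · intro h
    have ht := Set.ext_iff.1 h s((i, j), (i, j + 1))
    have hb := Set.ext_iff.1 h s((i + 1, j), (i + 1, j + 1))
    have hl := Set.ext_iff.1 h s((i, j), (i + 1, j))
    have hr := Set.ext_iff.1 h s((i, j + 1), (i + 1, j + 1))
    simp only [Set.mem_inter_iff, Set.mem_union, SimpleGraph.mem_edgeSet, mem_squareHoriz,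
      mem_squareVert, Sym2.eq_iff, Prod.mk.injEq] at ht hb hl hr
    simp [hi, him, hj, hjn] at ht hb hl hr
    simp only [OnlyHoriz]
    grind
  · rintro ⟨ht, hb, hl, hr⟩
    ext e
    simp only [Set.mem_inter_iff, Set.mem_union, mem_squareHoriz, mem_squareVert]
    constructor
    · rintro ⟨he, h | ⟨rfl, -⟩ | ⟨rfl, -⟩⟩
      · exact h
      · exact absurd he hl
      · exact absurd he hr
    · rintro (⟨rfl, h⟩ | ⟨rfl, h⟩)
      · exact ⟨ht, Or.inl (Or.inl ⟨rfl, h⟩)⟩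
      · exact ⟨hb.2 h.1, Or.inl (Or.inr ⟨rfl, h⟩)⟩

theorem onlyVert_iff {m n i j : ℕ} {F : SimpleGraph (ℕ × ℕ)} (hF : F ≤ gridGraph m n)
    (hi : 1 ≤ i) (him : i ≤ m) (hj : 1 ≤ j) (hjn : j ≤ n) :
    F.edgeSet ∩ (squareHoriz m n i j ∪ squareVert m n i j) = squareVert m n i j ↔
      OnlyVert n F i j := by
  have hR : F.Adj (i, j + 1) (i + 1, j + 1) → j < n := fun h =>
    (gridGraph_adj_vert.1 (hF h)).2.2
  have hB : F.Adj (i + 1, j) (i + 1, j + 1) → i < m := fun h =>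
    (gridGraph_adj_horiz.1 (hF h)).2.1
  constructor
  · intro h
    have ht := Set.ext_iff.1 h s((i, j), (i, j + 1))
    have hb := Set.ext_iff.1 h s((i + 1, j), (i + 1, j + 1))
    have hl := Set.ext_iff.1 h s((i, j), (i + 1, j))
    have hr := Set.ext_iff.1 h s((i, j + 1), (i + 1, j + 1))
    simp only [Set.mem_inter_iff, Set.mem_union, SimpleGraph.mem_edgeSet, mem_squareHoriz,
      mem_squareVert, Sym2.eq_iff, Prod.mk.injEq] at ht hb hl hr
    simp [hi, him, hj, hjn] at ht hb hl hr
    simp only [OnlyVert]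
    grind
  · rintro ⟨ht, hb, hl, hr⟩
    ext e
    simp only [Set.mem_inter_iff, Set.mem_union, mem_squareHoriz, mem_squareVert]
    constructor
    · rintro ⟨he, (⟨rfl, -⟩ | ⟨rfl, -⟩) | h⟩
      · exact absurd he hl
      · exact absurd he hr
      · exact h
    · rintro (⟨rfl, h⟩ | ⟨rfl, h⟩)
      · exact ⟨ht, Or.inr (Or.inl ⟨rfl, h⟩)⟩
      · exact ⟨hb.2 h.2, Or.inr (Or.inr ⟨rfl, h⟩)⟩

/-- `P` is one of the two parity classes: it separates consecutive numbers. -/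
def IsParity (P : ℕ → Prop) : Prop := ∀ k, P (k + 1) ↔ ¬ P k

theorem isParity_even : IsParity Even := fun _ => Nat.even_add_one

theorem isParity_odd : IsParity Odd := fun k => by
  rw [← Nat.not_even_iff_odd, ← Nat.not_even_iff_odd, Nat.even_add_one]

theorem IsParity.iff_mod {P : ℕ → Prop} (hP : IsParity P) (a b : ℕ) (h : a % 2 = b % 2) :
    P a ↔ P b := by
  have h2 : ∀ c k, P (c + 2 * k) ↔ P c := by
    intro c k
    induction k with
    | zero => simp
    | succ k ih =>
      rw [show c + 2 * (k + 1) = c + 2 * k + 1 + 1 by ring, hP, hP, not_not, ih]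
  rw [← Nat.mod_add_div a 2, ← Nat.mod_add_div b 2, h2, h2, h]

/-- An edge of the grid lies in only one square of a given parity. -/
theorem square_unique {m n i j i' j' : ℕ} {P : ℕ → Prop} (hP : IsParity P) (h : P (i + j))
    (h' : P (i' + j')) {e : Sym2 (ℕ × ℕ)} (he : e ∈ squareHoriz m n i j ∪ squareVert m n i j)
    (he' : e ∈ squareHoriz m n i' j' ∪ squareVert m n i' j') : i = i' ∧ j = j' := by
  have key : (i + j) % 2 = (i' + j') % 2 := by
    by_contra hne
    have := hP.iff_mod (i + j) (i' + j' + 1) (by omega)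
    rw [hP] at this
    tauto
  simp only [Set.mem_union, mem_squareHoriz, mem_squareVert] at he he'
  rcases he with (⟨rfl, -⟩ | ⟨rfl, -⟩) | (⟨rfl, -⟩ | ⟨rfl, -⟩) <;>
    simp only [Sym2.eq_iff, Prod.mk.injEq] at he' <;> omega

theorem actOnSquares_adj {m n i j : ℕ} {P : ℕ → Prop} (hP : IsParity P) (hi : i ≤ m)
    (hj : j ≤ n) (h : P (i + j)) {F : SimpleGraph (ℕ × ℕ)} {u v : ℕ × ℕ}
    (he : s(u, v) ∈ squareHoriz m n i j ∪ squareVert m n i j) :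
    (actOnSquares m n P F).Adj u v ↔ (localAction m n i j F).Adj u v := by
  simp only [actOnSquares, SimpleGraph.fromEdgeSet_adj, Set.mem_ofPred_eq]
  constructor
  · rintro ⟨⟨i', j', _, _, h', he', hl⟩, -⟩
    obtain ⟨rfl, rfl⟩ := square_unique hP h h' he he'
    exact hl
  · intro hl
    exact ⟨⟨i, j, hi, hj, h, he, hl⟩, hl.ne⟩

theorem actOnSquares_le (m n : ℕ) (P : ℕ → Prop) (F : SimpleGraph (ℕ × ℕ)) :
    actOnSquares m n P F ≤ gridGraph m n := by
  intro u v h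
  simp only [actOnSquares, SimpleGraph.fromEdgeSet_adj, Set.mem_ofPred_eq] at h
  obtain ⟨⟨i, j, _, _, _, he | he, -⟩, -⟩ := h
  · exact he.2
  · exact he.2

/-- The action on all squares of one parity, read off on one of these squares. -/
theorem actOnSquares_square {m n i j : ℕ} {P : ℕ → Prop} (hP : IsParity P) (hi : i ≤ m)
    (hj : j ≤ n) (h : P (i + j)) {F : SimpleGraph (ℕ × ℕ)} (hF : F ≤ gridGraph m n) :
    (1 ≤ i ∧ 1 ≤ j ∧ OnlyHoriz m F i j ∧ OnlyVert n (actOnSquares m n P F) i j) ∨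
    (1 ≤ i ∧ 1 ≤ j ∧ OnlyVert n F i j ∧ OnlyHoriz m (actOnSquares m n P F) i j) ∨
    (¬ (1 ≤ i ∧ 1 ≤ j ∧ (OnlyHoriz m F i j ∨ OnlyVert n F i j)) ∧
      SameOnSquare F (actOnSquares m n P F) i j) := by
  set E := actOnSquares m n P F with hE
  have hEg : E ≤ gridGraph m n := actOnSquares_le m n P F
  have hadj : ∀ u v, s(u, v) ∈ squareHoriz m n i j ∪ squareVert m n i j →
    (E.Adj u v ↔ (localAction m n i j F).Adj u v) :=
      fun u v he => actOnSquares_adj hP hi hj h he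
  simp only [Set.mem_union, mem_squareHoriz, mem_squareVert] at hadj
  have ht : 1 ≤ i → (E.Adj (i, j) (i, j + 1) ↔ (localAction m n i j F).Adj (i, j) (i, j + 1)) :=
    fun h1 => hadj _ _ (Or.inl (Or.inl ⟨rfl, h1, hi, hj⟩))
  have hb : i < m → (E.Adj (i + 1, j) (i + 1, j + 1) ↔
      (localAction m n i j F).Adj (i + 1, j) (i + 1, j + 1)) :=
    fun h1 => hadj _ _ (Or.inl (Or.inr ⟨rfl, h1, hj⟩))
  have hl : 1 ≤ j → (E.Adj (i, j) (i + 1, j) ↔ (localAction m n i j F).Adj (i, j) (i + 1, j)) :=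
    fun h1 => hadj _ _ (Or.inr (Or.inl ⟨rfl, hi, h1, hj⟩))
  have hr : j < n → (E.Adj (i, j + 1) (i + 1, j + 1) ↔
      (localAction m n i j F).Adj (i, j + 1) (i + 1, j + 1)) :=
    fun h1 => hadj _ _ (Or.inr (Or.inr ⟨rfl, hi, h1⟩))
  have hsame : localAction m n i j F = F → SameOnSquare F E i j := by
    intro hloc
    rw [hloc] at ht hb hl hr
    have vt : ∀ G ≤ gridGraph m n, G.Adj (i, j) (i, j + 1) → 1 ≤ i := fun G hG h =>
      (gridGraph_adj_horiz.1 (hG h)).1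
    have vb : ∀ G ≤ gridGraph m n, G.Adj (i + 1, j) (i + 1, j + 1) → i < m := fun G hG h =>
      (gridGraph_adj_horiz.1 (hG h)).2.1
    have vl : ∀ G ≤ gridGraph m n, G.Adj (i, j) (i + 1, j) → 1 ≤ j := fun G hG h =>
      (gridGraph_adj_vert.1 (hG h)).2.1
    have vr : ∀ G ≤ gridGraph m n, G.Adj (i, j + 1) (i + 1, j + 1) → j < n := fun G hG h =>
      (gridGraph_adj_vert.1 (hG h)).2.2
    refine ⟨?_, ?_, ?_, ?_⟩
    · exact ⟨fun h => (ht (vt E hEg h)).1 h, fun h => (ht (vt F hF h)).2 h⟩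
    · exact ⟨fun h => (hb (vb E hEg h)).1 h, fun h => (hb (vb F hF h)).2 h⟩
    · exact ⟨fun h => (hl (vl E hEg h)).1 h, fun h => (hl (vl F hF h)).2 h⟩
    · exact ⟨fun h => (hr (vr E hEg h)).1 h, fun h => (hr (vr F hF h)).2 h⟩
  by_cases h0 : i = 0 ∨ j = 0
  · exact Or.inr (Or.inr ⟨by omega, hsame (by rw [localAction, if_pos h0])⟩)
  have hi1 : 1 ≤ i := by omega
  have hj1 : 1 ≤ j := by omega
  have vb : E.Adj (i + 1, j) (i + 1, j + 1) → i < m := fun h =>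
    (gridGraph_adj_horiz.1 (hEg h)).2.1
  have vr : E.Adj (i, j + 1) (i + 1, j + 1) → j < n := fun h =>
    (gridGraph_adj_vert.1 (hEg h)).2.2
  have eH := onlyHoriz_iff hF hi1 hi hj1 hj
  have eV := onlyVert_iff hF hi1 hi hj1 hj
  by_cases hH : OnlyHoriz m F i j
  · left
    refine ⟨hi1, hj1, hH, ?_⟩
    rw [localAction, if_neg h0, if_pos (eH.2 hH)] at ht hb hl hr
    simp only [SimpleGraph.fromEdgeSet_adj, Set.mem_union, Set.mem_sdiff, mem_squareHoriz,
      mem_squareVert, SimpleGraph.mem_edgeSet, Sym2.eq_iff, Prod.mk.injEq] at ht hb hl hr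
    simp [hi1, hi, hj1, hj] at ht hb hl hr
    simp only [OnlyVert]
    grind
  by_cases hV : OnlyVert n F i j
  · right; left
    refine ⟨hi1, hj1, hV, ?_⟩
    rw [localAction, if_neg h0, if_neg (eH.not.2 hH), if_pos (eV.2 hV)] at ht hb hl hr
    simp only [SimpleGraph.fromEdgeSet_adj, Set.mem_union, Set.mem_sdiff, mem_squareHoriz,
      mem_squareVert, SimpleGraph.mem_edgeSet, Sym2.eq_iff, Prod.mk.injEq] at ht hb hl hr
    simp [hi1, hi, hj1, hj] at ht hb hl hr
    simp only [OnlyHoriz]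
    grind
  · exact Or.inr (Or.inr ⟨fun h => h.2.2.elim hH hV, hsame (by
      rw [localAction, if_neg h0, if_neg (eH.not.2 hH), if_neg (eV.not.2 hV)])⟩)

/-! ### Half-steps -/

/-- `D` arises from `F` by the local action on all squares of parity `P`, followed by taking the
complement in the grid. On a square away from the first row and column on which `F` has exactly
the horizontal or exactly the vertical edges, the two operations cancel; on every other square
only the complement remains. -/
structure IsHalfStep (m n : ℕ) (P : ℕ → Prop) (F D : SimpleGraph (ℕ × ℕ)) : Prop where
  le_left : F ≤ gridGraph m n
  le_right : D ≤ gridGraph m n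
  square : ∀ i j, i ≤ m → j ≤ n → P (i + j) →
    (1 ≤ i ∧ 1 ≤ j ∧ (OnlyHoriz m F i j ∨ OnlyVert n F i j) ∧ SameOnSquare F D i j) ∨
    (¬ (1 ≤ i ∧ 1 ≤ j ∧ (OnlyHoriz m F i j ∨ OnlyVert n F i j)) ∧ ComplOnSquare m n F D i j)

theorem complOnSquare_sdiff {m n i j : ℕ} (hi : i ≤ m) (hj : j ≤ n) (E : SimpleGraph (ℕ × ℕ)) :
    ComplOnSquare m n E (gridGraph m n \ E) i j := by
  simp only [ComplOnSquare, SimpleGraph.sdiff_adj, gridGraph_adj_horiz, gridGraph_adj_vert]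
  refine ⟨?_, ?_, ?_, ?_⟩ <;> refine and_congr_left fun _ => ?_ <;> omega

/-- The local action on the squares of one parity, followed by the complement. -/
theorem isHalfStep_sdiff_actOnSquares {m n : ℕ} {P : ℕ → Prop} (hP : IsParity P)
    {F : SimpleGraph (ℕ × ℕ)} (hF : F ≤ gridGraph m n) :
    IsHalfStep m n P F (gridGraph m n \ actOnSquares m n P F) := by
  refine ⟨hF, sdiff_le, fun i j hi hj h => ?_⟩
  have hc := complOnSquare_sdiff hi hj (actOnSquares m n P F)
  have hact := actOnSquares_square hP hi hj h hF
  revert hc hact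
  generalize actOnSquares m n P F = E
  generalize gridGraph m n \ E = D
  simp only [OnlyHoriz, OnlyVert, SameOnSquare, ComplOnSquare]
  grind

/-- The complement, followed by the local action on the squares of one parity. -/
theorem isHalfStep_actOnSquares_sdiff {m n : ℕ} {P : ℕ → Prop} (hP : IsParity P)
    {E : SimpleGraph (ℕ × ℕ)} (hE : E ≤ gridGraph m n) :
    IsHalfStep m n P (gridGraph m n \ E) (actOnSquares m n P E) := by
  refine ⟨sdiff_le, actOnSquares_le m n P E, fun i j hi hj h => ?_⟩
  have hc := complOnSquare_sdiff hi hj E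
  have hact := actOnSquares_square hP hi hj h hE
  have vt : E.Adj (i, j) (i, j + 1) → 1 ≤ i := fun h => (gridGraph_adj_horiz.1 (hE h)).1
  have vb : E.Adj (i + 1, j) (i + 1, j + 1) → i < m := fun h =>
    (gridGraph_adj_horiz.1 (hE h)).2.1
  have vl : E.Adj (i, j) (i + 1, j) → 1 ≤ j := fun h => (gridGraph_adj_vert.1 (hE h)).2.1
  have vr : E.Adj (i, j + 1) (i + 1, j + 1) → j < n := fun h =>
    (gridGraph_adj_vert.1 (hE h)).2.2
  revert hc hact
  generalize actOnSquares m n P E = G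
  generalize gridGraph m n \ E = D
  simp only [OnlyHoriz, OnlyVert, SameOnSquare, ComplOnSquare]
  grind

theorem IsHalfStep.symm {m n : ℕ} {P : ℕ → Prop} {F D : SimpleGraph (ℕ × ℕ)}
    (h : IsHalfStep m n P F D) : IsHalfStep m n P D F := by
  refine ⟨h.le_right, h.le_left, fun i j hi hj hij => ?_⟩
  have hs := h.square i j hi hj hij
  have vt : F.Adj (i, j) (i, j + 1) → 1 ≤ i := fun h' =>
    (gridGraph_adj_horiz.1 (h.le_left h')).1
  have vb : F.Adj (i + 1, j) (i + 1, j + 1) → i < m := fun h' =>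
    (gridGraph_adj_horiz.1 (h.le_left h')).2.1
  have vl : F.Adj (i, j) (i + 1, j) → 1 ≤ j := fun h' =>
    (gridGraph_adj_vert.1 (h.le_left h')).2.1
  have vr : F.Adj (i, j + 1) (i + 1, j + 1) → j < n := fun h' =>
    (gridGraph_adj_vert.1 (h.le_left h')).2.2
  revert hs
  simp only [OnlyHoriz, OnlyVert, SameOnSquare, ComplOnSquare]
  grind

/-! ### Degrees and boundary conditions under a half-step -/

/-- Exactly two of the four edges of `F` at the vertex `(x + 1, y + 1)` are present. -/
def TwoEdgesAt (F : SimpleGraph (ℕ × ℕ)) (x y : ℕ) : Prop :=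
  (F.Adj (x + 1, y + 1) (x + 1, y + 1 + 1) ∧ F.Adj (x + 1, y + 1) (x + 1 + 1, y + 1) ∧
    ¬ F.Adj (x + 1, y) (x + 1, y + 1) ∧ ¬ F.Adj (x, y + 1) (x + 1, y + 1)) ∨
  (F.Adj (x + 1, y + 1) (x + 1, y + 1 + 1) ∧ ¬ F.Adj (x + 1, y + 1) (x + 1 + 1, y + 1) ∧
    F.Adj (x + 1, y) (x + 1, y + 1) ∧ ¬ F.Adj (x, y + 1) (x + 1, y + 1)) ∨
  (F.Adj (x + 1, y + 1) (x + 1, y + 1 + 1) ∧ ¬ F.Adj (x + 1, y + 1) (x + 1 + 1, y + 1) ∧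
    ¬ F.Adj (x + 1, y) (x + 1, y + 1) ∧ F.Adj (x, y + 1) (x + 1, y + 1)) ∨
  (¬ F.Adj (x + 1, y + 1) (x + 1, y + 1 + 1) ∧ F.Adj (x + 1, y + 1) (x + 1 + 1, y + 1) ∧
    F.Adj (x + 1, y) (x + 1, y + 1) ∧ ¬ F.Adj (x, y + 1) (x + 1, y + 1)) ∨
  (¬ F.Adj (x + 1, y + 1) (x + 1, y + 1 + 1) ∧ F.Adj (x + 1, y + 1) (x + 1 + 1, y + 1) ∧
    ¬ F.Adj (x + 1, y) (x + 1, y + 1) ∧ F.Adj (x, y + 1) (x + 1, y + 1)) ∨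
  (¬ F.Adj (x + 1, y + 1) (x + 1, y + 1 + 1) ∧ ¬ F.Adj (x + 1, y + 1) (x + 1 + 1, y + 1) ∧
    F.Adj (x + 1, y) (x + 1, y + 1) ∧ F.Adj (x, y + 1) (x + 1, y + 1))

theorem gridGraph_adj_inner {m n x y : ℕ} {v : ℕ × ℕ}
    (h : (gridGraph m n).Adj (x + 1, y + 1) v) :
    v = (x + 1, y + 1 + 1) ∨ v = (x + 1 + 1, y + 1) ∨ v = (x + 1, y) ∨ v = (x, y + 1) := by
  obtain ⟨i, j, ⟨_, _, _, e | e⟩ | ⟨_, _, _, e | e⟩⟩ := gridGraph_adj_cases h <;>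
    obtain ⟨e, rfl⟩ := e <;> simp only [Prod.mk.injEq] at e ⊢ <;> omega

/-- A vertex that is not an inner vertex has at most one neighbour in the grid. -/
theorem gridGraph_adj_unique {m n : ℕ} {u v w : ℕ × ℕ}
    (hu : u.1 = 0 ∨ u.2 = 0 ∨ m < u.1 ∨ n < u.2) (hv : (gridGraph m n).Adj u v)
    (hw : (gridGraph m n).Adj u w) : v = w := by
  obtain ⟨i, j, ⟨_, _, _, e | e⟩ | ⟨_, _, _, e | e⟩⟩ := gridGraph_adj_cases hv <;>
  obtain ⟨i', j', ⟨_, _, _, e' | e'⟩ | ⟨_, _, _, e' | e'⟩⟩ := gridGraph_adj_cases hw <;>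
  obtain ⟨rfl, rfl⟩ := e <;> obtain ⟨e', rfl⟩ := e' <;>
  simp only [Prod.mk.injEq] at hu e' ⊢ <;> omega

theorem ncard_neighborSet_eq_two_iff {m n : ℕ} {F : SimpleGraph (ℕ × ℕ)}
    (hF : F ≤ gridGraph m n) (x y : ℕ) :
    (F.neighborSet (x + 1, y + 1)).ncard = 2 ↔ TwoEdgesAt F x y := by
  classical
  have hset : F.neighborSet (x + 1, y + 1) =
      ((({(x + 1, y + 1 + 1), (x + 1 + 1, y + 1), (x + 1, y), (x, y + 1)} :
        Finset (ℕ × ℕ)).filter (fun v => F.Adj (x + 1, y + 1) v) : Finset (ℕ × ℕ)) :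
          Set (ℕ × ℕ)) := by
    ext v
    simp only [SimpleGraph.mem_neighborSet, Finset.coe_filter, Finset.mem_insert,
      Finset.mem_singleton, Set.mem_ofPred_eq]
    exact ⟨fun h => ⟨gridGraph_adj_inner (hF h), h⟩, fun h => h.2⟩
  rw [hset, Set.ncard_coe_finset, TwoEdgesAt, F.adj_comm (x + 1, y), F.adj_comm (x, y + 1)]
  have hx : x + 1 + 1 ≠ x := by omega
  have hy : y + 1 + 1 ≠ y := by omega
  by_cases h1 : F.Adj (x + 1, y + 1) (x + 1, y + 1 + 1) <;>
  by_cases h2 : F.Adj (x + 1, y + 1) (x + 1 + 1, y + 1) <;>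
  by_cases h3 : F.Adj (x + 1, y + 1) (x + 1, y) <;>
  by_cases h4 : F.Adj (x + 1, y + 1) (x, y + 1) <;>
  simp [Finset.filter_insert, Finset.filter_singleton, hx, hy, h1, h2, h3, h4]

/-- A half-step preserves the degree at inner vertices: in each of the two squares of parity `P`
at the vertex, a local degree `d` becomes `2 - d`. -/
theorem IsHalfStep.twoEdgesAt {m n : ℕ} {P : ℕ → Prop} (hP : IsParity P)
    {F D : SimpleGraph (ℕ × ℕ)} (h : IsHalfStep m n P F D) {x y : ℕ} (hx : x < m) (hy : y < n)
    (hF : TwoEdgesAt F x y) : TwoEdgesAt D x y := by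
  by_cases hp : P (x + y)
  · have h1 := h.square x y (by omega) (by omega) hp
    have h2 := h.square (x + 1) (y + 1) (by omega) (by omega)
      ((hP.iff_mod _ (x + y) (by omega)).2 hp)
    revert h1 h2 hF
    simp only [OnlyHoriz, OnlyVert, SameOnSquare, ComplOnSquare, TwoEdgesAt]
    grind (splits := 30)
  · have hp' : P (x + y + 1) := (hP _).2 hp
    have h1 := h.square (x + 1) y (by omega) (by omega)
      ((hP.iff_mod _ (x + y + 1) (by omega)).2 hp')
    have h2 := h.square x (y + 1) (by omega) (by omega) hp'
    revert h1 h2 hF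
    simp only [OnlyHoriz, OnlyVert, SameOnSquare, ComplOnSquare, TwoEdgesAt]
    grind (splits := 30)

theorem IsHalfStep.top_boundary {m n : ℕ} {P : ℕ → Prop} (hP : IsParity P)
    {F D : SimpleGraph (ℕ × ℕ)} (h : IsHalfStep m n P F D) {j : ℕ} (hj : 1 ≤ j) (hjn : j ≤ n) :
    D.Adj (0, j) (1, j) ↔ ¬ F.Adj (0, j) (1, j) := by
  by_cases hp : P j
  · rcases h.square 0 j (by omega) hjn (by simpa using hp) with h1 | ⟨-, h1⟩
    · omega
    · simpa [hj] using h1.2.2.1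
  · obtain ⟨k, rfl⟩ := Nat.exists_eq_add_of_le' hj
    rw [hP, not_not] at hp
    rcases h.square 0 k (by omega) (by omega) (by simpa using hp) with h1 | ⟨-, h1⟩
    · omega
    · simpa [show k < n by omega] using h1.2.2.2

theorem IsHalfStep.left_boundary {m n : ℕ} {P : ℕ → Prop} (hP : IsParity P)
    {F D : SimpleGraph (ℕ × ℕ)} (h : IsHalfStep m n P F D) {i : ℕ} (hi : 1 ≤ i) (him : i ≤ m) :
    D.Adj (i, 0) (i, 1) ↔ ¬ F.Adj (i, 0) (i, 1) := by
  by_cases hp : P i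
  · rcases h.square i 0 him (by omega) (by simpa using hp) with h1 | ⟨-, h1⟩
    · omega
    · simpa [hi] using h1.1
  · obtain ⟨k, rfl⟩ := Nat.exists_eq_add_of_le' hi
    rw [hP, not_not] at hp
    rcases h.square k 0 (by omega) (by omega) (by simpa using hp) with h1 | ⟨-, h1⟩
    · omega
    · simpa [show k < m by omega] using h1.2.1

/-- The properties of a configuration that are shared by partial fully-packed loop configurations
and their complements: inner vertices have degree two, and along the left and top boundary the
edges are alternately present and absent. -/
structure IsAlternating (m n : ℕ) (F : SimpleGraph (ℕ × ℕ)) : Prop where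
  le_grid : F ≤ gridGraph m n
  two_edges : ∀ x y, x < m → y < n → TwoEdgesAt F x y
  top : ∀ j, 1 ≤ j → j < n → (F.Adj (0, j + 1) (1, j + 1) ↔ ¬ F.Adj (0, j) (1, j))
  left : ∀ i, 1 ≤ i → i < m → (F.Adj (i + 1, 0) (i + 1, 1) ↔ ¬ F.Adj (i, 0) (i, 1))
  corner : 1 ≤ m → 1 ≤ n → (F.Adj (0, 1) (1, 1) ↔ ¬ F.Adj (1, 0) (1, 1))

theorem IsPartialFPL.isAlternating {m n : ℕ} {F : SimpleGraph (ℕ × ℕ)}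
    (h : IsPartialFPL m n F) : IsAlternating m n F where
  le_grid := h.le_grid
  two_edges x y hx hy := (ncard_neighborSet_eq_two_iff h.le_grid x y).1
    (h.degree_two (x + 1) (y + 1) (by omega) (by omega) (by omega) (by omega))
  top j hj hjn := by
    rw [h.top_boundary j hj hjn.le, h.top_boundary (j + 1) (by omega) hjn]
    exact isParity_odd j
  left i hi him := by
    rw [h.left_boundary i hi him.le, h.left_boundary (i + 1) (by omega) him]
    exact isParity_even i
  corner hm hn := by
    rw [h.top_boundary 1 le_rfl hn, h.left_boundary 1 le_rfl hm]
    decide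

theorem IsHalfStep.isAlternating {m n : ℕ} {P : ℕ → Prop} (hP : IsParity P)
    {F D : SimpleGraph (ℕ × ℕ)} (h : IsHalfStep m n P F D) (hF : IsAlternating m n F) :
    IsAlternating m n D where
  le_grid := h.le_right
  two_edges x y hx hy := h.twoEdgesAt hP hx hy (hF.two_edges x y hx hy)
  top j hj hjn := by
    rw [h.top_boundary hP hj hjn.le, h.top_boundary hP (by omega) hjn, hF.top j hj hjn]
  left i hi him := by
    rw [h.left_boundary hP hi him.le, h.left_boundary hP (by omega) him, hF.left i hi him]
  corner hm hn := by
    rw [h.top_boundary hP le_rfl hn, h.left_boundary hP le_rfl hm, hF.corner hm hn]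

/-! ### Connectivity under a half-step -/

/-- The edge between `u` and `v` belongs to `F` and lies in the `P`-square at `q`. -/
def SquarePiece (m n : ℕ) (P : ℕ → Prop) (F : SimpleGraph (ℕ × ℕ)) (q u v : ℕ × ℕ) : Prop :=
  F.Adj u v ∧ q.1 ≤ m ∧ q.2 ≤ n ∧ P (q.1 + q.2) ∧
    s(u, v) ∈ squareHoriz m n q.1 q.2 ∪ squareVert m n q.1 q.2

theorem SquarePiece.symm {m n : ℕ} {P : ℕ → Prop} {F : SimpleGraph (ℕ × ℕ)} {q u v : ℕ × ℕ}
    (h : SquarePiece m n P F q u v) : SquarePiece m n P F q v u := by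
  refine ⟨h.1.symm, h.2.1, h.2.2.1, h.2.2.2.1, ?_⟩
  rw [Sym2.eq_swap]
  exact h.2.2.2.2

theorem exists_squarePiece {m n : ℕ} {P : ℕ → Prop} (hP : IsParity P)
    {F : SimpleGraph (ℕ × ℕ)} (hF : F ≤ gridGraph m n) {u v : ℕ × ℕ} (h : F.Adj u v) :
    ∃ q, SquarePiece m n P F q u v := by
  suffices hs : ∃ i j, i ≤ m ∧ j ≤ n ∧ P (i + j) ∧
      s(u, v) ∈ squareHoriz m n i j ∪ squareVert m n i j by
    obtain ⟨i, j, hs⟩ := hs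
    exact ⟨(i, j), h, hs⟩
  simp only [Set.mem_union, mem_squareHoriz, mem_squareVert]
  obtain ⟨i, j, ⟨h1, h2, h3, he⟩ | ⟨h1, h2, h3, he⟩⟩ := gridGraph_adj_cases (hF h)
  · have he : s(u, v) = s((i, j), (i, j + 1)) := by
      rcases he with ⟨rfl, rfl⟩ | ⟨rfl, rfl⟩
      · rfl
      · exact Sym2.eq_swap
    by_cases hp : P (i + j)
    · exact ⟨i, j, h2, h3, hp, Or.inl (Or.inl ⟨he, h1, h2, h3⟩)⟩
    · obtain ⟨k, rfl⟩ := Nat.exists_eq_add_of_le' h1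
      rw [hP.iff_mod (k + 1 + j) (k + j + 1) (by omega), hP, not_not] at hp
      exact ⟨k, j, by omega, h3, hp, Or.inl (Or.inr ⟨he, by omega, h3⟩)⟩
  · have he : s(u, v) = s((i, j), (i + 1, j)) := by
      rcases he with ⟨rfl, rfl⟩ | ⟨rfl, rfl⟩
      · rfl
      · exact Sym2.eq_swap
    by_cases hp : P (i + j)
    · exact ⟨i, j, h1, h3, hp, Or.inr (Or.inl ⟨he, h1, h2, h3⟩)⟩
    · obtain ⟨k, rfl⟩ := Nat.exists_eq_add_of_le' h2
      rw [hP.iff_mod (i + (k + 1)) (i + k + 1) (by omega), hP, not_not] at hp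
      exact ⟨i, k, h1, by omega, hp, Or.inr (Or.inr ⟨he, h1, by omega⟩)⟩

theorem SquarePiece.corner {m n i j : ℕ} {P : ℕ → Prop} {F : SimpleGraph (ℕ × ℕ)}
    {u v : ℕ × ℕ} (h : SquarePiece m n P F (i, j) u v) :
    (u = (i, j) ∧ (F.Adj (i, j) (i, j + 1) ∨ F.Adj (i, j) (i + 1, j))) ∨
    (u = (i, j + 1) ∧ (F.Adj (i, j) (i, j + 1) ∨ F.Adj (i, j + 1) (i + 1, j + 1))) ∨
    (u = (i + 1, j) ∧ (F.Adj (i + 1, j) (i + 1, j + 1) ∨ F.Adj (i, j) (i + 1, j))) ∨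
    (u = (i + 1, j + 1) ∧
      (F.Adj (i + 1, j) (i + 1, j + 1) ∨ F.Adj (i, j + 1) (i + 1, j + 1))) := by
  obtain ⟨h, -, -, -, he⟩ := h
  simp only [Set.mem_union, mem_squareHoriz, mem_squareVert, Sym2.eq_iff] at he
  rcases he with (⟨⟨rfl, rfl⟩ | ⟨rfl, rfl⟩, -⟩ | ⟨⟨rfl, rfl⟩ | ⟨rfl, rfl⟩, -⟩) |
    (⟨⟨rfl, rfl⟩ | ⟨rfl, rfl⟩, -⟩ | ⟨⟨rfl, rfl⟩ | ⟨rfl, rfl⟩, -⟩)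
  · exact Or.inl ⟨rfl, Or.inl h⟩
  · exact Or.inr (Or.inl ⟨rfl, Or.inl h.symm⟩)
  · exact Or.inr (Or.inr (Or.inl ⟨rfl, Or.inl h⟩))
  · exact Or.inr (Or.inr (Or.inr ⟨rfl, Or.inl h.symm⟩))
  · exact Or.inl ⟨rfl, Or.inr h⟩
  · exact Or.inr (Or.inr (Or.inl ⟨rfl, Or.inr h.symm⟩))
  · exact Or.inr (Or.inl ⟨rfl, Or.inr h⟩)
  · exact Or.inr (Or.inr (Or.inr ⟨rfl, Or.inr h.symm⟩))

/-- A vertex is a crossing if it lies on the left or top boundary, or if it is an inner vertex at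
which `F` passes from one `P`-square to another one, that is, if `F` has one edge at the vertex in
each of the two `P`-squares there. By `TwoEdgesAt` it suffices to require this for one of the two
squares; the one that contains the edge to the right is chosen. -/
def IsCrossing (m n : ℕ) (P : ℕ → Prop) (F : SimpleGraph (ℕ × ℕ)) (u : ℕ × ℕ) : Prop :=
  u.1 = 0 ∨ u.2 = 0 ∨ (u.1 ≤ m ∧ u.2 ≤ n ∧
    (P (u.1 + u.2) → (F.Adj u (u.1, u.2 + 1) ↔ ¬ F.Adj u (u.1 + 1, u.2))) ∧
    (¬ P (u.1 + u.2) → (F.Adj u (u.1, u.2 + 1) ↔ ¬ F.Adj (u.1 - 1, u.2) u)))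

theorem isCrossing_inner {m n : ℕ} {P : ℕ → Prop} {F : SimpleGraph (ℕ × ℕ)} (x y : ℕ) :
    IsCrossing m n P F (x + 1, y + 1) ↔ x < m ∧ y < n ∧
      (P (x + 1 + (y + 1)) → (F.Adj (x + 1, y + 1) (x + 1, y + 1 + 1) ↔
        ¬ F.Adj (x + 1, y + 1) (x + 1 + 1, y + 1))) ∧
      (¬ P (x + 1 + (y + 1)) → (F.Adj (x + 1, y + 1) (x + 1, y + 1 + 1) ↔
        ¬ F.Adj (x, y + 1) (x + 1, y + 1))) := by
  simp [IsCrossing]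

/-- A vertex that is not a crossing meets the edges of `F` in at most one `P`-square. -/
theorem squarePiece_unique {m n : ℕ} {P : ℕ → Prop} (hP : IsParity P)
    {F : SimpleGraph (ℕ × ℕ)} (hF : IsAlternating m n F) {u q q' v v' : ℕ × ℕ}
    (hu : ¬ IsCrossing m n P F u) (h : SquarePiece m n P F q u v)
    (h' : SquarePiece m n P F q' u v') : q = q' := by
  obtain ⟨a, b⟩ := u
  obtain ⟨x, rfl⟩ : ∃ x, a = x + 1 := Nat.exists_eq_succ_of_ne_zero fun h0 => hu (Or.inl h0)
  obtain ⟨y, rfl⟩ : ∃ y, b = y + 1 :=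
    Nat.exists_eq_succ_of_ne_zero fun h0 => hu (Or.inr (Or.inl h0))
  by_cases hxy : x < m ∧ y < n
  · obtain ⟨i, j⟩ := q
    obtain ⟨i', j'⟩ := q'
    have ht := hF.two_edges x y hxy.1 hxy.2
    have hp := h.2.2.2.1
    have hp' := h'.2.2.2.1
    have h1 := h.corner
    have h1' := h'.corner
    rw [isCrossing_inner] at hu
    clear h h'
    have e1 : P (x + 1 + (y + 1)) ↔ P (x + y) := hP.iff_mod _ _ (by omega)
    have e2 : P (x + 1 + y) ↔ ¬ P (x + y) := by
      rw [← hP]; exact hP.iff_mod _ _ (by omega)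
    have e3 : P (x + (y + 1)) ↔ ¬ P (x + y) := hP _
    simp only [Prod.mk.injEq] at *
    rw [TwoEdgesAt] at ht
    rcases h1 with ⟨⟨rfl, rfl⟩, h1⟩ | ⟨⟨rfl, h0⟩, h1⟩ | ⟨⟨h0, rfl⟩, h1⟩ | ⟨⟨h0, h00⟩, h1⟩ <;>
    rcases h1' with ⟨⟨rfl, rfl⟩, h1'⟩ | ⟨⟨rfl, h2⟩, h1'⟩ | ⟨⟨h2, rfl⟩, h1'⟩ | ⟨⟨h2, h22⟩, h1'⟩ <;>
    simp only [Nat.add_right_cancel_iff] at * <;> subst_vars <;> grind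
  · -- A vertex on the right or lower boundary has only one neighbour.
    have hv : v = v' :=
      gridGraph_adj_unique (by simp only; omega) (hF.le_grid h.1) (hF.le_grid h'.1)
    subst hv
    exact Prod.ext_iff.2 (square_unique hP h.2.2.2.1 h'.2.2.2.1 h.2.2.2.2 h'.2.2.2.2)

/-- At a crossing, each `P`-square contains exactly one edge of `F`. -/
theorem IsAlternating.crossing_corner {m n i j : ℕ} {P : ℕ → Prop} (hP : IsParity P)
    {F : SimpleGraph (ℕ × ℕ)} (hF : IsAlternating m n F) (hp : P (i + j)) :
    (1 ≤ i → 1 ≤ j → IsCrossing m n P F (i, j) →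
      (F.Adj (i, j) (i, j + 1) ↔ ¬ F.Adj (i, j) (i + 1, j))) ∧
    (1 ≤ i → IsCrossing m n P F (i, j + 1) →
      j < n ∧ (F.Adj (i, j) (i, j + 1) ↔ ¬ F.Adj (i, j + 1) (i + 1, j + 1))) ∧
    (1 ≤ j → IsCrossing m n P F (i + 1, j) →
      i < m ∧ (F.Adj (i + 1, j) (i + 1, j + 1) ↔ ¬ F.Adj (i, j) (i + 1, j))) ∧
    (IsCrossing m n P F (i + 1, j + 1) →
      i < m ∧ j < n ∧
        (F.Adj (i + 1, j) (i + 1, j + 1) ↔ ¬ F.Adj (i, j + 1) (i + 1, j + 1))) := by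
  refine ⟨fun hi hj hc => ?_, fun hi hc => ?_, fun hj hc => ?_, fun hc => ?_⟩
  · obtain ⟨x, rfl⟩ := Nat.exists_eq_add_of_le' hi
    obtain ⟨y, rfl⟩ := Nat.exists_eq_add_of_le' hj
    exact ((isCrossing_inner x y).1 hc).2.2.1 hp
  · obtain ⟨x, rfl⟩ := Nat.exists_eq_add_of_le' hi
    obtain ⟨hx, hy, -, h⟩ := (isCrossing_inner x j).1 hc
    have := h (by rw [← Nat.add_assoc, hP]; exact not_not.2 hp)
    have ht := hF.two_edges x j hx hy
    rw [TwoEdgesAt] at ht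
    grind
  · obtain ⟨y, rfl⟩ := Nat.exists_eq_add_of_le' hj
    obtain ⟨hx, hy, -, h⟩ := (isCrossing_inner i y).1 hc
    exact ⟨hx, h (by
      rw [hP.iff_mod _ (i + (y + 1) + 1) (by omega), hP]; exact not_not.2 hp)⟩
  · obtain ⟨hx, hy, h, -⟩ := (isCrossing_inner i j).1 hc
    have := h ((hP.iff_mod _ (i + j) (by omega)).2 hp)
    have ht := hF.two_edges i j hx hy
    rw [TwoEdgesAt] at ht
    grind

/-- The move of boundary vertices in a half-step: a vertex on the left or top boundary is sent to
the other boundary vertex of the `P`-square that contains its edge. At the two ends of the left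
and top boundary this is the first vertex `(m + 1, 1)` of the lower boundary or the first vertex
`(1, n + 1)` of the right boundary. All other vertices are fixed. -/
def boundaryMove (m n : ℕ) (P : ℕ → Prop) [DecidablePred P] (u : ℕ × ℕ) : ℕ × ℕ :=
  if u.1 = 0 then
    if P u.2 then (if u.2 = n then (1, n + 1) else (0, u.2 + 1))
    else (if u.2 = 1 then (1, 0) else (0, u.2 - 1))
  else if u.2 = 0 then
    if P u.1 then (if u.1 = m then (m + 1, 1) else (u.1 + 1, 0))
    else (if u.1 = 1 then (0, 1) else (u.1 - 1, 0))
  else u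

theorem boundaryMove_inner (m n : ℕ) (P : ℕ → Prop) [DecidablePred P] {i j : ℕ} (hi : 1 ≤ i)
    (hj : 1 ≤ j) : boundaryMove m n P (i, j) = (i, j) := by
  rw [boundaryMove, if_neg (by simp; omega), if_neg (by simp; omega)]

/-- If `F` is replaced by its complement in a square, then the corners where `F` has exactly one
edge of the square are in one component of the complement, unless `F` has exactly the horizontal
or exactly the vertical edges. Here `t`, `b`, `l`, `r` are the edges of `F` on the top, bottom,
left and right, `B` and `R` say whether the bottom and right edges belong to the grid, and
`p₁`, …, `p₄` are the values of a predicate on the upper left, upper right, lower left and lower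
right corner. -/
theorem exists_value_of_compl {t b l r B R p₁ p₂ p₃ p₄ : Prop} (hbB : b → B) (hrR : r → R)
    (hh : ¬ (t ∧ (b ↔ B) ∧ ¬ l ∧ ¬ r)) (hv : ¬ (l ∧ (r ↔ R) ∧ ¬ t ∧ ¬ b))
    (ht : ¬ t → (p₁ ↔ p₂)) (hb : B → ¬ b → (p₃ ↔ p₄)) (hl : ¬ l → (p₁ ↔ p₃))
    (hr : R → ¬ r → (p₂ ↔ p₄)) :
    ∃ c : Prop, ((t ↔ ¬ l) → (p₁ ↔ c)) ∧ (R → (t ↔ ¬ r) → (p₂ ↔ c)) ∧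
      (B → (b ↔ ¬ l) → (p₃ ↔ c)) ∧ (B → R → (b ↔ ¬ r) → (p₄ ↔ c)) := by
  by_cases h₁ : t ↔ ¬ l
  · refine ⟨p₁, ?_⟩
    grind
  by_cases h₂ : R ∧ (t ↔ ¬ r)
  · refine ⟨p₂, ?_⟩
    grind
  by_cases h₃ : B ∧ (b ↔ ¬ l)
  · refine ⟨p₃, ?_⟩
    grind
  · refine ⟨p₄, ?_⟩
    grind

/-- In a square on which `D` is the complement of `F`, all crossings with an edge of `F` in the
square are moved into one component of `D`. -/
theorem IsAlternating.exists_value_of_complOnSquare {m n i j : ℕ} {P : ℕ → Prop}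
    [DecidablePred P] (hP : IsParity P) {F D : SimpleGraph (ℕ × ℕ)} (hm : 1 ≤ m) (hn : 1 ≤ n)
    (hF : IsAlternating m n F) (hi : i ≤ m) (hj : j ≤ n) (hp : P (i + j))
    (hpar : ¬ (1 ≤ i ∧ 1 ≤ j ∧ (OnlyHoriz m F i j ∨ OnlyVert n F i j)))
    (hc : ComplOnSquare m n F D i j) (p : ℕ × ℕ → Prop)
    (hpD : ∀ u v, D.Adj u v → (p u ↔ p v)) :
    ∃ c : Prop, ∀ u v, IsCrossing m n P F u → SquarePiece m n P F (i, j) u v →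
      (c ↔ p (boundaryMove m n P u)) := by
  obtain ⟨c1, c2, c3, c4⟩ := hF.crossing_corner hP hp
  obtain ⟨ht, hb, hl, hr⟩ := hc
  have vF := hF.le_grid
  have vt : F.Adj (i, j) (i, j + 1) → 1 ≤ i := fun h => (gridGraph_adj_horiz.1 (vF h)).1
  have vb : F.Adj (i + 1, j) (i + 1, j + 1) → i < m := fun h => (gridGraph_adj_horiz.1 (vF h)).2.1
  have vl : F.Adj (i, j) (i + 1, j) → 1 ≤ j := fun h => (gridGraph_adj_vert.1 (vF h)).2.1
  have vr : F.Adj (i, j + 1) (i + 1, j + 1) → j < n := fun h => (gridGraph_adj_vert.1 (vF h)).2.2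
  have pt : 1 ≤ i → ¬ F.Adj (i, j) (i, j + 1) → (p (i, j) ↔ p (i, j + 1)) :=
    fun h1 h2 => hpD _ _ (ht.2 ⟨h1, h2⟩)
  have pb : i < m → ¬ F.Adj (i + 1, j) (i + 1, j + 1) → (p (i + 1, j) ↔ p (i + 1, j + 1)) :=
    fun h1 h2 => hpD _ _ (hb.2 ⟨h1, h2⟩)
  have pl : 1 ≤ j → ¬ F.Adj (i, j) (i + 1, j) → (p (i, j) ↔ p (i + 1, j)) :=
    fun h1 h2 => hpD _ _ (hl.2 ⟨h1, h2⟩)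
  have pr : j < n → ¬ F.Adj (i, j + 1) (i + 1, j + 1) → (p (i, j + 1) ↔ p (i + 1, j + 1)) :=
    fun h1 h2 => hpD _ _ (hr.2 ⟨h1, h2⟩)
  suffices hs : ∃ c : Prop,
      (IsCrossing m n P F (i, j) → (F.Adj (i, j) (i, j + 1) ∨ F.Adj (i, j) (i + 1, j)) →
        (c ↔ p (boundaryMove m n P (i, j)))) ∧
      (IsCrossing m n P F (i, j + 1) →
        (F.Adj (i, j) (i, j + 1) ∨ F.Adj (i, j + 1) (i + 1, j + 1)) →
        (c ↔ p (boundaryMove m n P (i, j + 1)))) ∧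
      (IsCrossing m n P F (i + 1, j) →
        (F.Adj (i + 1, j) (i + 1, j + 1) ∨ F.Adj (i, j) (i + 1, j)) →
        (c ↔ p (boundaryMove m n P (i + 1, j)))) ∧
      (IsCrossing m n P F (i + 1, j + 1) →
        (F.Adj (i + 1, j) (i + 1, j + 1) ∨ F.Adj (i, j + 1) (i + 1, j + 1)) →
        (c ↔ p (boundaryMove m n P (i + 1, j + 1)))) by
    obtain ⟨c, h1, h2, h3, h4⟩ := hs
    refine ⟨c, fun u v hu huv => ?_⟩
    rcases huv.corner with ⟨rfl, h⟩ | ⟨rfl, h⟩ | ⟨rfl, h⟩ | ⟨rfl, h⟩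
    · exact h1 hu h
    · exact h2 hu h
    · exact h3 hu h
    · exact h4 hu h
  have m4 : boundaryMove m n P (i + 1, j + 1) = (i + 1, j + 1) :=
    boundaryMove_inner m n P (by omega) (by omega)
  have q1 : ¬ P (i + j + 1) := by rw [hP]; exact not_not.2 hp
  rcases Nat.eq_zero_or_pos i with rfl | hi1 <;> rcases Nat.eq_zero_or_pos j with rfl | hj1
  · -- The corner square: the boundary vertices `(0, 1)` and `(1, 0)` are exchanged.
    have hcor := hF.corner hm hn
    have m2 : boundaryMove m n P (0, 0 + 1) = (1, 0) := by
      simp [boundaryMove, show ¬ P 1 by simpa using q1]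
    have m3 : boundaryMove m n P (0 + 1, 0) = (0, 1) := by
      simp [boundaryMove, show ¬ P 1 by simpa using q1]
    rw [m2, m3, m4]
    refine ⟨p (1, 1), ?_⟩
    simp only [Nat.zero_add] at *
    grind
  · -- A square on the top boundary: `(0, j)` and its right neighbour are exchanged.
    have hpj : P j := by simpa using hp
    have m2 : boundaryMove m n P (0, j + 1) = (0, j) := by
      simp [boundaryMove, show ¬ P (j + 1) by simpa using q1, show j ≠ 0 by omega]
    have m3 : boundaryMove m n P (0 + 1, j) = (1, j) := boundaryMove_inner m n P le_rfl hj1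
    rw [m2, m3, m4]
    rcases hj.lt_or_eq with hjn | rfl
    · have htop := hF.top j hj1 hjn
      have m1 : boundaryMove m n P (0, j) = (0, j + 1) := by
        simp [boundaryMove, hpj, show j ≠ n by omega]
      rw [m1]
      simp only [Nat.zero_add] at *
      by_cases hleft : F.Adj (0, j) (1, j)
      · refine ⟨p (1, j + 1), ?_⟩
        grind
      · refine ⟨p (1, j), ?_⟩
        grind
    · have m1 : boundaryMove m j P (0, j) = (1, j + 1) := by
        simp [boundaryMove, hpj]
      rw [m1]
      simp only [Nat.zero_add] at *
      by_cases hleft : F.Adj (0, j) (1, j)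
      · refine ⟨p (1, j + 1), ?_⟩
        grind
      · refine ⟨p (1, j), ?_⟩
        grind
  · -- A square on the left boundary: `(i, 0)` and its lower neighbour are exchanged.
    have hpi : P i := by simpa using hp
    have m2 : boundaryMove m n P (i, 0 + 1) = (i, 1) := boundaryMove_inner m n P hi1 le_rfl
    have m3 : boundaryMove m n P (i + 1, 0) = (i, 0) := by
      simp [boundaryMove, show ¬ P (i + 1) by simpa using q1, show i ≠ 0 by omega]
    rw [m2, m3, m4]
    rcases hi.lt_or_eq with him | rfl
    · have hleft := hF.left i hi1 him
      have m1 : boundaryMove m n P (i, 0) = (i + 1, 0) := by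
        simp [boundaryMove, hpi, show i ≠ 0 by omega, show i ≠ m by omega]
      rw [m1]
      simp only [Nat.zero_add] at *
      by_cases htop : F.Adj (i, 0) (i, 1)
      · refine ⟨p (i + 1, 1), ?_⟩
        grind
      · refine ⟨p (i, 1), ?_⟩
        grind
    · have m1 : boundaryMove i n P (i, 0) = (i + 1, 1) := by
        simp [boundaryMove, hpi, show i ≠ 0 by omega]
      rw [m1]
      simp only [Nat.zero_add] at *
      by_cases htop : F.Adj (i, 0) (i, 1)
      · refine ⟨p (i + 1, 1), ?_⟩
        grind
      · refine ⟨p (i, 1), ?_⟩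
        grind
  · rw [boundaryMove_inner m n P hi1 hj1, boundaryMove_inner m n P hi1 (by omega : 1 ≤ j + 1),
      boundaryMove_inner m n P (by omega : 1 ≤ i + 1) hj1, m4]
    simp only [OnlyHoriz, OnlyVert] at hpar
    obtain ⟨c, h1, h2, h3, h4⟩ := exists_value_of_compl vb vr
      (fun h => hpar ⟨hi1, hj1, Or.inl h⟩) (fun h => hpar ⟨hi1, hj1, Or.inr h⟩)
      (pt hi1) pb (pl hj1) pr
    refine ⟨c, fun h _ => (h1 (c1 hi1 hj1 h)).symm, fun h _ => ?_, fun h _ => ?_, fun h _ => ?_⟩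
    · exact (h2 (c2 hi1 h).1 (c2 hi1 h).2).symm
    · exact (h3 (c3 hj1 h).1 (c3 hj1 h).2).symm
    · exact (h4 (c4 h).1 (c4 h).2.1 (c4 h).2.2).symm

/-- A half-step preserves the connections between vertices on the left and top boundary, up to
`boundaryMove`. -/
theorem IsHalfStep.reachable {m n : ℕ} {P : ℕ → Prop} [DecidablePred P] (hP : IsParity P)
    {F D : SimpleGraph (ℕ × ℕ)} (h : IsHalfStep m n P F D) (hF : IsAlternating m n F)
    (hm : 1 ≤ m) (hn : 1 ≤ n) {u v : ℕ × ℕ} (hu : u.1 = 0 ∨ u.2 = 0) (hv : v.1 = 0 ∨ v.2 = 0)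
    (huv : F.Reachable u v) :
    D.Reachable (boundaryMove m n P u) (boundaryMove m n P v) := by
  refine SimpleGraph.Reachable.transfer_of_pieces (SquarePiece m n P F)
    (fun _ _ _ => SquarePiece.symm) (fun _ _ => exists_squarePiece hP h.le_left)
    (IsCrossing m n P F) (boundaryMove m n P)
    (fun u hu q q' v v' h1 h2 => squarePiece_unique hP hF hu h1 h2) ?_
    (hu.imp_right Or.inl) (hv.imp_right Or.inl) huv
  rintro p hp ⟨i, j⟩
  by_cases hq : i ≤ m ∧ j ≤ n ∧ P (i + j)
  · obtain ⟨hi, hj, hij⟩ := hq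
    rcases h.square i j hi hj hij with ⟨hi1, hj1, -, hs⟩ | ⟨hpar, hc⟩
    · refine ⟨p, fun u v huv => ?_, fun u v hu huv => ?_⟩
      · obtain ⟨hs1, hs2, hs3, hs4⟩ := hs
        apply hp
        obtain ⟨hadj, -, -, -, he⟩ := huv
        simp only [Set.mem_union, mem_squareHoriz, mem_squareVert, Sym2.eq_iff] at he
        rcases he with (⟨⟨rfl, rfl⟩ | ⟨rfl, rfl⟩, -⟩ | ⟨⟨rfl, rfl⟩ | ⟨rfl, rfl⟩, -⟩) |
          (⟨⟨rfl, rfl⟩ | ⟨rfl, rfl⟩, -⟩ | ⟨⟨rfl, rfl⟩ | ⟨rfl, rfl⟩, -⟩)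
        · exact hs1.2 hadj
        · exact (hs1.2 hadj.symm).symm
        · exact hs2.2 hadj
        · exact (hs2.2 hadj.symm).symm
        · exact hs3.2 hadj
        · exact (hs3.2 hadj.symm).symm
        · exact hs4.2 hadj
        · exact (hs4.2 hadj.symm).symm
      · have : boundaryMove m n P u = u := by
          rcases huv.corner with ⟨rfl, -⟩ | ⟨rfl, -⟩ | ⟨rfl, -⟩ | ⟨rfl, -⟩ <;>
            exact boundaryMove_inner m n P (by omega) (by omega)
        rw [this]
    · obtain ⟨c, hc⟩ := hF.exists_value_of_complOnSquare hP hm hn hi hj hij hpar hc p hp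
      exact ⟨fun _ => c, fun _ _ _ => Iff.rfl, hc⟩
  · have hno : ∀ u v, ¬ SquarePiece m n P F (i, j) u v :=
      fun u v huv => hq ⟨huv.2.1, huv.2.2.1, huv.2.2.2.1⟩
    exact ⟨p, fun u v huv => absurd huv (hno u v), fun u v _ huv => absurd huv (hno u v)⟩

/-! ### Partial link patterns -/

/-- A graph in which inner vertices have two edges has maximum degree two. -/
theorem IsAlternating.eq_of_adj {m n : ℕ} {F : SimpleGraph (ℕ × ℕ)} (hF : IsAlternating m n F)
    {u a b c : ℕ × ℕ} (ha : F.Adj u a) (hb : F.Adj u b) (hc : F.Adj u c) :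
    a = b ∨ a = c ∨ b = c := by
  by_cases hu : u.1 = 0 ∨ u.2 = 0 ∨ m < u.1 ∨ n < u.2
  · exact Or.inl (gridGraph_adj_unique hu (hF.le_grid ha) (hF.le_grid hb))
  · obtain ⟨x, y⟩ := u
    simp only [not_or] at hu
    obtain ⟨x, rfl⟩ := Nat.exists_eq_succ_of_ne_zero hu.1
    obtain ⟨y, rfl⟩ := Nat.exists_eq_succ_of_ne_zero hu.2.1
    have ht := hF.two_edges x y (by omega) (by omega)
    rw [TwoEdgesAt, F.adj_comm (x + 1, y), F.adj_comm (x, y + 1)] at ht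
    rcases gridGraph_adj_inner (hF.le_grid ha) with rfl | rfl | rfl | rfl <;>
    rcases gridGraph_adj_inner (hF.le_grid hb) with rfl | rfl | rfl | rfl <;>
    rcases gridGraph_adj_inner (hF.le_grid hc) with rfl | rfl | rfl | rfl <;>
    first
    | exact Or.inl rfl
    | exact Or.inr (Or.inl rfl)
    | exact Or.inr (Or.inr rfl)
    | (exfalso; grind)

/-- The left and top boundary vertices in the order of their labels, at positions `1, …, m + n`,
together with the first vertex of the lower boundary at position `0` and the first vertex of the
right boundary at position `m + n + 1`. -/
def boundaryVertex (m n t : ℕ) : ℕ × ℕ :=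
  if t = 0 then (m + 1, 1) else if t ≤ m then (m + 1 - t, 0)
  else if t ≤ m + n then (0, t - m) else (1, n + 1)

theorem boundaryVertex_injOn {m n t t' : ℕ} (hm : 1 ≤ m) (ht : t ≤ m + n + 1)
    (ht' : t' ≤ m + n + 1) (h : boundaryVertex m n t = boundaryVertex m n t') : t = t' := by
  unfold boundaryVertex at h
  split_ifs at h <;> simp only [Prod.mk.injEq] at h <;> omega

theorem boundaryVertex_left_or_top {m n t : ℕ} (ht : 1 ≤ t) (htm : t ≤ m + n) :
    (boundaryVertex m n t).1 = 0 ∨ (boundaryVertex m n t).2 = 0 := by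
  unfold boundaryVertex
  split_ifs <;> omega

theorem boundaryVertex_not_inner (m n t : ℕ) :
    (boundaryVertex m n t).1 = 0 ∨ (boundaryVertex m n t).2 = 0 ∨
      m < (boundaryVertex m n t).1 ∨ n < (boundaryVertex m n t).2 := by
  unfold boundaryVertex
  split_ifs <;> simp

theorem boundaryMove_boundaryVertex {m n t : ℕ} {P : ℕ → Prop} [DecidablePred P]
    (hP : IsParity P) (hm : 1 ≤ m) (hn : 1 ≤ n) (ht : 1 ≤ t) (htm : t ≤ m + n) :
    boundaryMove m n P (boundaryVertex m n t) =
      boundaryVertex m n (if P (t + m) then t + 1 else t - 1) := by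
  by_cases hl : t ≤ m
  · have hp : P (m + 1 - t) ↔ ¬ P (t + m) := by
      rw [← hP]; exact hP.iff_mod _ _ (by omega)
    have hb : boundaryVertex m n t = (m + 1 - t, 0) := by
      rw [boundaryVertex, if_neg (by omega), if_pos hl]
    rw [hb]
    unfold boundaryMove boundaryVertex
    by_cases hpt : P (t + m) <;>
      simp only [hp, hpt, not_true_eq_false, not_false_eq_true, Nat.add_one_ne_zero, if_true,
        if_false] <;>
      split_ifs <;> simp only [Prod.mk.injEq, and_true, true_and] <;> omega
  · have hp : P (t - m) ↔ P (t + m) := hP.iff_mod _ _ (by omega)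
    have hb : boundaryVertex m n t = (0, t - m) := by
      rw [boundaryVertex, if_neg (by omega), if_neg hl, if_pos htm]
    rw [hb]
    unfold boundaryMove boundaryVertex
    by_cases hpt : P (t + m) <;>
      simp only [hp, hpt, Nat.add_one_ne_zero, if_true, if_false] <;>
      split_ifs <;> simp only [Prod.mk.injEq, and_true, true_and] <;> omega

/-- The position of a label: the boundary vertices carrying labels are those at every second
position, starting with `1` or `2` according to the parity of `m`. -/
theorem labelVertex_eq_boundaryVertex {m n l : ℕ} (hl : 1 ≤ l) (hln : l ≤ numLabels m n) :
    labelVertex m l = boundaryVertex m n (2 * l - 1 + m % 2) := by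
  unfold numLabels at hln
  unfold labelVertex boundaryVertex
  split_ifs <;> simp only [Prod.mk.injEq, and_true, true_and] <;> omega

/-- Three distinct boundary positions cannot be connected to each other. -/
theorem IsAlternating.not_three_connected {m n : ℕ} {F : SimpleGraph (ℕ × ℕ)}
    (hF : IsAlternating m n F) (hm : 1 ≤ m) {a b c : ℕ} (ha : a ≤ m + n + 1)
    (hb : b ≤ m + n + 1) (hc : c ≤ m + n + 1) (hab : a ≠ b) (hac : a ≠ c) (hbc : b ≠ c)
    (h : F.Reachable (boundaryVertex m n a) (boundaryVertex m n b))
    (h' : F.Reachable (boundaryVertex m n a) (boundaryVertex m n c)) : False := by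
  have hone : ∀ t, ∀ v w, F.Adj (boundaryVertex m n t) v → F.Adj (boundaryVertex m n t) w →
      v = w := fun t v w hv hw =>
    gridGraph_adj_unique (boundaryVertex_not_inner m n t) (hF.le_grid hv) (hF.le_grid hw)
  rcases SimpleGraph.eq_or_eq_of_reachable_of_degree_le_one
    (fun u a b c => hF.eq_of_adj) (hone a) (hone b) (hone c) h
    (fun e => hab (boundaryVertex_injOn hm ha hb e)) h' with e | e
  · exact hac (boundaryVertex_injOn hm hc ha e).symm
  · exact hbc (boundaryVertex_injOn hm hc hb e).symm

/-- Without inner vertices, no two labels are connected. -/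
theorem not_linkConnected_of_eq_zero {m n : ℕ} (h0 : m = 0 ∨ n = 0) {F : SimpleGraph (ℕ × ℕ)}
    (hF : F ≤ gridGraph m n) (a b : ℕ) : ¬ LinkConnected m n F a b := by
  rintro ⟨ha, hb, hab, ⟨w⟩⟩
  simp only [Finset.mem_Icc, numLabels] at ha hb
  -- All edges are vertical if `m = 0`, and horizontal if `n = 0`.
  have key : ∀ {u v : ℕ × ℕ}, F.Walk u v → (m = 0 ∧ u.2 = v.2) ∨ (n = 0 ∧ u.1 = v.1) := by
    intro u v w
    induction w with
    | nil => rcases h0 with h | h <;> simp [h]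
    | cons h _ ih =>
      obtain ⟨i, j, ⟨_, _, _, e | e⟩ | ⟨_, _, _, e | e⟩⟩ := gridGraph_adj_cases (hF h) <;>
      obtain ⟨rfl, rfl⟩ := e <;> simp only at ih ⊢ <;> omega
  have := key w
  unfold labelVertex at this
  split_ifs at this <;> simp only at this <;> omega

theorem LinkConnected.symm {m n : ℕ} {F : SimpleGraph (ℕ × ℕ)} {a b : ℕ}
    (h : LinkConnected m n F a b) : LinkConnected m n F b a :=
  ⟨h.2.1, h.1, h.2.2.1.symm, h.2.2.2.symm⟩

/-- Two half-steps, on the even and on the odd squares, move each label down by one. Labels that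
are connected to the lowest label become connected to the lower boundary. -/
theorem linkConnected_of_two_halfSteps {m n : ℕ} (hm : 1 ≤ m) (hn : 1 ≤ n)
    {F D G : SimpleGraph (ℕ × ℕ)} (hF : IsAlternating m n F) (h₁ : IsHalfStep m n Even F D)
    (h₂ : IsHalfStep m n Odd D G) {i j : ℕ} (h : LinkConnected m n F i j) :
    (2 ≤ i → 2 ≤ j → LinkConnected m n G (i - 1) (j - 1)) ∧
      (j = 1 → ∀ k, ¬ LinkConnected m n G (i - 1) k) := by
  have hD := h₁.isAlternating isParity_even hF
  have hG := h₂.isAlternating isParity_odd hD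
  obtain ⟨hi, hj, hij, hr⟩ := h
  rw [Finset.mem_Icc] at hi hj
  have hN : ∀ l, l ≤ numLabels m n → 2 * l - 1 + m % 2 ≤ m + n := by
    intro l hl
    unfold numLabels at hl
    omega
  rw [labelVertex_eq_boundaryVertex hi.1 hi.2, labelVertex_eq_boundaryVertex hj.1 hj.2] at hr
  have step₁ : ∀ l, 1 ≤ l → l ≤ numLabels m n →
      boundaryMove m n Even (boundaryVertex m n (2 * l - 1 + m % 2)) =
        boundaryVertex m n (2 * l - 2 + m % 2) := by
    intro l h1 hl
    rw [boundaryMove_boundaryVertex isParity_even hm hn (by omega) (hN l hl),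
      if_neg (by rw [Nat.even_iff]; omega)]
    congr 1
    omega
  have step₂ : ∀ l, 1 ≤ 2 * l - 2 + m % 2 → l ≤ numLabels m n →
      boundaryMove m n Odd (boundaryVertex m n (2 * l - 2 + m % 2)) =
        boundaryVertex m n (2 * l - 2 + m % 2 - 1) := by
    intro l h1 hl
    have := hN l hl
    rw [boundaryMove_boundaryVertex isParity_odd hm hn h1 (by omega),
      if_neg (by rw [Nat.odd_iff]; omega)]
  have step₂' : ∀ l, 1 ≤ l → l ≤ numLabels m n →
      boundaryMove m n Odd (boundaryVertex m n (2 * l - 1 + m % 2)) =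
        boundaryVertex m n (2 * l + m % 2) := by
    intro l h1 hl
    rw [boundaryMove_boundaryVertex isParity_odd hm hn (by omega) (hN l hl),
      if_pos (by rw [Nat.odd_iff]; omega)]
    congr 1
    omega
  have hrD : D.Reachable (boundaryVertex m n (2 * i - 2 + m % 2))
      (boundaryVertex m n (2 * j - 2 + m % 2)) := by
    rw [← step₁ i hi.1 hi.2, ← step₁ j hj.1 hj.2]
    exact h₁.reachable isParity_even hF hm hn
      (boundaryVertex_left_or_top (by omega) (hN i hi.2))
      (boundaryVertex_left_or_top (by omega) (hN j hj.2)) hr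
  have hrG : 1 ≤ 2 * i - 2 + m % 2 → 1 ≤ 2 * j - 2 + m % 2 →
      G.Reachable (boundaryVertex m n (2 * i - 2 + m % 2 - 1))
        (boundaryVertex m n (2 * j - 2 + m % 2 - 1)) := by
    intro h1 h2
    have hNi := hN i hi.2
    have hNj := hN j hj.2
    rw [← step₂ i h1 hi.2, ← step₂ j h2 hj.2]
    exact h₂.reachable isParity_odd hD hm hn
      (boundaryVertex_left_or_top h1 (by omega))
      (boundaryVertex_left_or_top h2 (by omega)) hrD
  refine ⟨fun hi2 hj2 => ⟨?_, ?_, by omega, ?_⟩, ?_⟩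
  · rw [Finset.mem_Icc]; omega
  · rw [Finset.mem_Icc]; omega
  · rw [labelVertex_eq_boundaryVertex (n := n) (by omega) (by omega),
      labelVertex_eq_boundaryVertex (n := n) (by omega) (by omega),
      show 2 * (i - 1) - 1 + m % 2 = 2 * i - 2 + m % 2 - 1 by omega,
      show 2 * (j - 1) - 1 + m % 2 = 2 * j - 2 + m % 2 - 1 by omega]
    exact hrG (by omega) (by omega)
  · rintro rfl k ⟨-, hk, hik, hrk⟩
    rw [Finset.mem_Icc] at hk
    have hNi := hN i hi.2
    have hNk := hN k hk.2
    rw [labelVertex_eq_boundaryVertex (n := n) (by omega) (by omega),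
      labelVertex_eq_boundaryVertex hk.1 hk.2] at hrk
    rcases Nat.mod_two_eq_zero_or_one m with hm2 | hm2
    · -- For even `m`, label `1` reaches the lower boundary in the first half-step. The connection
      -- of `i - 1` with `k` is carried back to `D` through the second half-step.
      have hkD := h₂.symm.reachable isParity_odd hG hm hn
        (boundaryVertex_left_or_top (by omega) (hN (i - 1) (by omega)))
        (boundaryVertex_left_or_top (by omega) hNk) hrk
      rw [step₂' (i - 1) (by omega) (by omega), step₂' k hk.1 hk.2,
        show 2 * (i - 1) = 2 * i - 2 by omega] at hkD
      exact hD.not_three_connected hm (by omega) (by omega) (by omega) (by omega) (by omega)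
        (by omega) hrD hkD
    · -- For odd `m`, label `1` reaches the lower boundary in the second half-step.
      rw [show 2 * (i - 1) - 1 + m % 2 = 2 * i - 2 + m % 2 - 1 by omega] at hrk
      exact hG.not_three_connected hm (by omega) (by omega) (by omega) (by omega) (by omega)
        (by omega) (hrG (by omega) (by omega)) hrk

theorem IsPartialFPL.of_two_halfSteps {m n : ℕ} {F D G : SimpleGraph (ℕ × ℕ)}
    (hF : IsPartialFPL m n F) {P Q : ℕ → Prop} (hP : IsParity P) (hQ : IsParity Q)
    (h₁ : IsHalfStep m n P F D) (h₂ : IsHalfStep m n Q D G) : IsPartialFPL m n G where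
  le_grid := h₂.le_right
  top_boundary j hj hjn := by
    rw [h₂.top_boundary hQ hj hjn, h₁.top_boundary hP hj hjn, not_not, hF.top_boundary j hj hjn]
  left_boundary i hi him := by
    rw [h₂.left_boundary hQ hi him, h₁.left_boundary hP hi him, not_not,
      hF.left_boundary i hi him]
  degree_two i j hi him hj hjn := by
    have hG := h₂.isAlternating hQ (h₁.isAlternating hP hF.isAlternating)
    obtain ⟨x, rfl⟩ := Nat.exists_eq_add_of_le' hi
    obtain ⟨y, rfl⟩ := Nat.exists_eq_add_of_le' hj
    exact (ncard_neighborSet_eq_two_iff hG.le_grid x y).2 (hG.two_edges x y him hjn)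

theorem mainTheorem3 (m n : ℕ) (F : SimpleGraph (ℕ × ℕ)) (hF : IsPartialFPL m n F) :
    IsPartialFPL m n (gyration m n F) ∧
      ∀ i j : ℕ, LinkConnected m n F i j →
        LinkConnected m n (gyration m n F) (i - 1) (j - 1) ∨
          ((∀ k : ℕ, ¬ LinkConnected m n (gyration m n F) (i - 1) k) ∧
            (∀ k : ℕ, ¬ LinkConnected m n (gyration m n F) (j - 1) k)) := by
  have h₁ := isHalfStep_sdiff_actOnSquares isParity_even hF.le_grid
  have h₂ : IsHalfStep m n Odd _ (gyration m n F) :=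
    isHalfStep_actOnSquares_sdiff isParity_odd (actOnSquares_le m n Even F)
  refine ⟨hF.of_two_halfSteps isParity_even isParity_odd h₁ h₂, fun i j hij => ?_⟩
  by_cases h0 : m = 0 ∨ n = 0
  · exact absurd hij (not_linkConnected_of_eq_zero h0 hF.le_grid i j)
  have key := fun {i j : ℕ} (h : LinkConnected m n F i j) =>
    linkConnected_of_two_halfSteps (by omega) (by omega) hF.isAlternating h₁ h₂ h
  -- The number `0` is not a label.
  have hzero : ∀ k, ¬ LinkConnected m n (gyration m n F) (1 - 1) k := by
    rintro k ⟨h, -⟩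
    simp at h
  have hi := Finset.mem_Icc.1 hij.1
  have hj := Finset.mem_Icc.1 hij.2.1
  rcases hi.1.eq_or_lt with rfl | hi2
  · exact Or.inr ⟨hzero, (key hij.symm).2 rfl⟩
  rcases hj.1.eq_or_lt with rfl | hj2
  · exact Or.inr ⟨(key hij).2 rfl, hzero⟩
  · exact Or.inl ((key hij).1 hi2 hj2)
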